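/- Let $\gamma_\infty:(0,1)\to(0,\infty)$ be smooth. (In the continuum approximation of a random waveguide with nearest-neighbour mode coupling, $\gamma_\infty$ is the limit coupling profile, $\gamma^{(N)}_{\lfloor xN\rfloor}\to\gamma_\infty(x)$ for $x\in(0,1)$, as the number $N$ of guided modes tends to infinity.) Let $D=\{(u,v)\in\mathbb R^2:\ 0<u<v<1\}$. In the continuum approximation the decay rate $\lambda$ of the mean mode powers is defined by $$\lambda=\inf_{\varphi\in\mathcal D_1}\int_0^1\gamma_\infty(u)\,\varphi'(u)^2\,du,$$ $$\mathcal D_1=\Big\{\varphi\in C^\infty([0,1]):\ \int_0^1\varphi(u)^2\,du=1,\ \varphi'(0)=0,\ \varphi(1)=0\Big\},$$ and the decay rate $\mu$ of the second-order moments of the mode powers is defined by $$\mu=\inf_{\psi\in\mathcal D_2}\iint_D\Big(\gamma_\infty(u)\,[\partial_u\psi(u,v)]^2+\gamma_\infty(v)\,[\partial_v\psi(u,v)]^2\Big)\,du\,dv,$$ $$\mathcal D_2=\Big\{\psi\in C^\infty(\overline D):\ \iint_D\psi^2\,du\,dv=1,\ \partial_u\psi(0,v)=0,\ \psi(u,1)=0,\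 (\partial_u\psi-\partial_v\psi)(u,u)=0\ \text{ for all } u,v\in[0,1]\Big\}.$$ The integrals of these non-negative functions are taken in $[0,\infty]$. Then $\lambda$ and $\mu$ are finite and $$\mu=2\lambda .$$ -/

import Mathlib

open Set MeasureTheory
open scoped ENNReal ContDiff

noncomputable section

namespace RandomWaveguide

/-- The test class `𝒟₁`: functions `φ ∈ C^∞([0,1])` (smooth up to the endpoints, one-sided derivatives
there) with `∫₀¹ φ² = 1`, `φ'(0) = 0` and `φ(1) = 0`. -/
def testClassOne : Set (ℝ → ℝ) :=
  {φ | ContDiffOn ℝ ∞ φ (Icc 0 1) ∧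
    (∫ u in Ioo (0 : ℝ) 1, φ u ^ 2) = 1 ∧
    derivWithin φ (Icc 0 1) 0 = 0 ∧
    φ 1 = 0}

/-- The energy `∫₀¹ γ(u) φ'(u)² du`, as an element of `[0, ∞]`. -/
def energyOne (γ φ : ℝ → ℝ) : ℝ≥0∞ :=
  ∫⁻ u in Ioo (0 : ℝ) 1, ENNReal.ofReal (γ u * derivWithin φ (Icc 0 1) u ^ 2)

/-- The decay rate of the mean mode powers in the continuum approximation:
the infimum of `∫₀¹ γ φ'²` over `φ ∈ 𝒟₁`. -/
def meanRate (γ : ℝ → ℝ) : ℝ≥0∞ :=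
  ⨅ φ ∈ testClassOne, energyOne γ φ

/-- The open triangle `D = {(u,v) : 0 < u < v < 1}`. -/
def triangle : Set (ℝ × ℝ) :=
  {p | 0 < p.1 ∧ p.1 < p.2 ∧ p.2 < 1}

/-- The closed triangle `{(u,v) : 0 ≤ u ≤ v ≤ 1}`, the closure of `triangle`. -/
def closedTriangle : Set (ℝ × ℝ) :=
  {p | 0 ≤ p.1 ∧ p.1 ≤ p.2 ∧ p.2 ≤ 1}

/-- The partial derivative `∂_u ψ` on the closed triangle. -/
def partialU (ψ : ℝ × ℝ → ℝ) (p : ℝ × ℝ) : ℝ :=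
  fderivWithin ℝ ψ closedTriangle p (1, 0)

/-- The partial derivative `∂_v ψ` on the closed triangle. -/
def partialV (ψ : ℝ × ℝ → ℝ) (p : ℝ × ℝ) : ℝ :=
  fderivWithin ℝ ψ closedTriangle p (0, 1)

/-- The test class `𝒟₂`: functions `ψ` smooth on the closed triangle with `∬_D ψ² = 1`,
`∂_u ψ(0,v) = 0`, `ψ(u,1) = 0` and `(∂_u - ∂_v) ψ = 0` on the diagonal `u = v`. -/
def testClassTwo : Set (ℝ × ℝ → ℝ) :=
  {ψ | ContDiffOn ℝ ∞ ψ closedTriangle ∧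
    (∫ p in triangle, ψ p ^ 2) = 1 ∧
    (∀ v ∈ Icc (0 : ℝ) 1, partialU ψ (0, v) = 0) ∧
    (∀ u ∈ Icc (0 : ℝ) 1, ψ (u, 1) = 0) ∧
    (∀ u ∈ Icc (0 : ℝ) 1, partialU ψ (u, u) - partialV ψ (u, u) = 0)}

/-- The energy `∬_D γ(u) (∂_u ψ)² + γ(v) (∂_v ψ)² du dv`, as an element of `[0, ∞]`. -/
def energyTwo (γ : ℝ → ℝ) (ψ : ℝ × ℝ → ℝ) : ℝ≥0∞ :=
  ∫⁻ p in triangle, ENNReal.ofReal (γ p.1 * partialU ψ p ^ 2 + γ p.2 * partialV ψ p ^ 2)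

/-- The decay rate of the second-order moments of the mode powers in the continuum approximation:
the infimum of the energy on the triangle over `ψ ∈ 𝒟₂`. -/
def secondMomentRate (γ : ℝ → ℝ) : ℝ≥0∞ :=
  ⨅ ψ ∈ testClassTwo, energyTwo γ ψ

end RandomWaveguide

end

namespace RandomWaveguide

/-! Extend `ψ` symmetrically to the square: the energy becomes that of two independent copies of the
one-dimensional problem, so the bottom of the spectrum should double.

Upper bound: for `φ` in `testClassOne`, the product `√2 φ(u) φ(v)` lies in `testClassTwo`, since
symmetry forces the diagonal condition, and its energy is twice that of `φ`
(`product_mem_testClassTwo`, `energyTwo_product`).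

Lower bound: fix `v` and follow the symmetric extension, `u ↦ ψ (min u v, max u v)`. This slice
satisfies both endpoint conditions but may have a corner at `u = v`, so it need not be a test
function. Flattening it near the corner costs arbitrarily little energy, because `γ` is bounded near
interior points; hence the Rayleigh bound survives (`meanRate_mul_le_of_piecewise`). Integrating
over `v`, Tonelli counts each energy term once (`energyTwo_eq`) but the mass `ψ²` twice
(`two_mul_lintegral_triangle_sq`). This is the factor 2. -/

/-! ### The one-dimensional Rayleigh quotient and its finiteness -/

lemma lintegral_sq_eq_one_iff {α : Type*} [MeasurableSpace α] {μ : Measure α} {f : α → ℝ}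
    (hf : AEStronglyMeasurable f μ) :
    ∫⁻ x, ENNReal.ofReal (f x ^ 2) ∂μ = 1 ↔ ∫ x, f x ^ 2 ∂μ = 1 := by
  rw [integral_eq_lintegral_of_nonneg_ae (Filter.Eventually.of_forall fun x => sq_nonneg (f x))
    (hf.pow 2), ENNReal.toReal_eq_one_iff]

/-- The Rayleigh quotient bound for unnormalised test functions. -/
lemma meanRate_mul_le_energyOne (γ : ℝ → ℝ) {φ : ℝ → ℝ} (hφ : ContDiffOn ℝ ∞ φ (Icc 0 1))
    (h0 : derivWithin φ (Icc 0 1) 0 = 0) (h1 : φ 1 = 0) :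
    meanRate γ * ∫⁻ u in Ioo (0 : ℝ) 1, ENNReal.ofReal (φ u ^ 2) ≤ energyOne γ φ := by
  have hint : IntegrableOn (fun u => φ u ^ 2) (Ioo 0 1) :=
    ((hφ.continuousOn.pow 2).integrableOn_Icc).mono_set Ioo_subset_Icc_self
  rw [← ofReal_integral_eq_lintegral_ofReal hint
    (Filter.Eventually.of_forall fun u => sq_nonneg (φ u))]
  set m := ∫ u in Ioo (0 : ℝ) 1, φ u ^ 2 with hm
  have hm0 : 0 ≤ m := integral_nonneg fun u => sq_nonneg (φ u)
  rcases hm0.eq_or_lt with h | hpos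
  · simp [← h]
  -- Scaling by `m^(-1/2)` normalises the mass; the energy scales by `m⁻¹`.
  set s := Real.sqrt m⁻¹ with hs
  have hs2 : s ^ 2 = m⁻¹ := Real.sq_sqrt (inv_nonneg.2 hm0)
  have hd (u : ℝ) : derivWithin (fun u => s * φ u) (Icc 0 1) u =
      s * derivWithin φ (Icc 0 1) u := derivWithin_const_mul_field s
  have hmem : (fun u => s * φ u) ∈ testClassOne := by
    refine ⟨contDiffOn_const.mul hφ, ?_, by simp [hd, h0], by simp [h1]⟩
    simp only [mul_pow, hs2]
    rw [integral_const_mul, ← hm, inv_mul_cancel₀ hpos.ne']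
  have hE : energyOne γ (fun u => s * φ u) = ENNReal.ofReal m⁻¹ * energyOne γ φ := by
    rw [energyOne, energyOne, ← lintegral_const_mul' _ _ ENNReal.ofReal_ne_top]
    refine lintegral_congr fun u => ?_
    rw [hd, ← ENNReal.ofReal_mul (inv_nonneg.2 hm0), mul_pow, hs2]
    ring_nf
  calc meanRate γ * ENNReal.ofReal m
      ≤ ENNReal.ofReal m⁻¹ * energyOne γ φ * ENNReal.ofReal m := by
        gcongr
        rw [← hE]
        exact iInf₂_le _ hmem
    _ = energyOne γ φ := by
        rw [mul_right_comm, ← ENNReal.ofReal_mul (inv_nonneg.2 hm0), inv_mul_cancel₀ hpos.ne']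
        simp

/-- `γ` may blow up at 0 and 1, so upper bounds are available only on compact subintervals. -/
lemma exists_forall_Icc_le {γ : ℝ → ℝ} (hγ : ContinuousOn γ (Ioo 0 1)) {a b : ℝ} (ha : 0 < a)
    (hb : b < 1) : ∃ Γ, 0 ≤ Γ ∧ ∀ u ∈ Icc a b, γ u ≤ Γ := by
  obtain ⟨C, hC⟩ := isCompact_Icc.exists_bound_of_continuousOn
    (hγ.mono (Icc_subset_Ioo ha hb))
  exact ⟨max C 0, le_max_right _ _, fun u hu =>
    (le_abs_self _).trans ((hC u hu).trans (le_max_left _ _))⟩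

/-- A function whose derivative agrees with that of `f` outside an interval compactly contained in
`(0,1)`, and is bounded on that interval, has an energy close to that of `f`. -/
lemma lintegral_energy_le_add {γ f' g' : ℝ → ℝ} {a b Γ M : ℝ}
    (hΓ0 : 0 ≤ Γ) (hΓ : ∀ u ∈ Icc a b, γ u ≤ Γ)
    (hM : ∀ᵐ u, u ∈ Icc a b → |g' u| ≤ M)
    (heq : ∀ u ∈ Ioo (0 : ℝ) 1, u ∉ Icc a b → g' u = f' u) :
    ∫⁻ u in Ioo (0 : ℝ) 1, ENNReal.ofReal (γ u * g' u ^ 2) ≤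
      (∫⁻ u in Ioo (0 : ℝ) 1, ENNReal.ofReal (γ u * f' u ^ 2)) +
        ENNReal.ofReal (Γ * M ^ 2) * ENNReal.ofReal (b - a) := by
  have hc : ENNReal.ofReal (Γ * M ^ 2) * ENNReal.ofReal (b - a) =
      ∫⁻ u, (Icc a b).indicator (fun _ => ENNReal.ofReal (Γ * M ^ 2)) u := by
    rw [lintegral_indicator measurableSet_Icc, setLIntegral_const, Real.volume_Icc]
  calc ∫⁻ u in Ioo (0 : ℝ) 1, ENNReal.ofReal (γ u * g' u ^ 2)
      ≤ ∫⁻ u in Ioo (0 : ℝ) 1, (ENNReal.ofReal (γ u * f' u ^ 2) +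
          (Icc a b).indicator (fun _ => ENNReal.ofReal (Γ * M ^ 2)) u) := by
        refine lintegral_mono_ae ?_
        filter_upwards [ae_restrict_mem measurableSet_Ioo, ae_restrict_of_ae hM] with u hu hMu
        by_cases h : u ∈ Icc a b
        · rw [indicator_of_mem h]
          refine le_add_left (ENNReal.ofReal_le_ofReal ?_)
          exact mul_le_mul (hΓ u h) (sq_le_sq.2 ((hMu h).trans (le_abs_self M)))
            (sq_nonneg _) hΓ0
        · rw [heq u hu h]
          exact le_self_add
    _ ≤ _ := by
        rw [lintegral_add_right _ (measurable_const.indicator measurableSet_Icc), hc]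
        gcongr
        exact Measure.restrict_le_self

/-- A bump equal to 1 near 0 and vanishing near 1 meets both endpoint conditions. On `(0,1)` its
derivative vanishes off `[1/4, 3/4]`, where `γ` is bounded, so its energy is finite while its mass
is positive. -/
lemma meanRate_ne_top {γ : ℝ → ℝ} (hγ : ContinuousOn γ (Ioo 0 1)) : meanRate γ ≠ ⊤ := by
  let S : ContDiffBump (0 : ℝ) := ⟨1 / 4, 3 / 4, by norm_num, by norm_num⟩
  have hS : ContDiff ℝ ∞ S := S.contDiff
  have hdw {u : ℝ} (hu : u ∈ Icc (0 : ℝ) 1) : derivWithin S (Icc 0 1) u = deriv S u :=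
    (hS.differentiable (by simp)).differentiableAt.derivWithin (uniqueDiffOn_Icc one_pos u hu)
  have hd0 {u : ℝ} (hu : |u| < 1 / 4) : deriv S u = 0 := by
    have : S =ᶠ[nhds u] fun _ => 1 := S.eventuallyEq_one_of_mem_ball (by simpa [S] using hu)
    rw [this.deriv_eq, deriv_const]
  have hd1 {u : ℝ} (hu : 3 / 4 < |u|) : deriv S u = 0 := by
    have : S =ᶠ[nhds u] fun _ => 0 := by
      filter_upwards [(isOpen_lt continuous_const continuous_abs).mem_nhds hu] with x hx
      exact S.zero_of_le_dist (by simpa [S] using hx.le)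
    rw [this.deriv_eq, deriv_const]
  obtain ⟨M, hM⟩ := isCompact_Icc.exists_bound_of_continuousOn (s := Icc (1 / 4 : ℝ) (3 / 4))
    (hS.continuous_deriv (by simp)).continuousOn
  obtain ⟨Γ, hΓ0, hΓ⟩ := exists_forall_Icc_le hγ (a := 1 / 4) (b := 3 / 4) (by norm_num)
    (by norm_num)
  have hE : energyOne γ S ≠ ⊤ := by
    -- Comparison with the zero derivative leaves only the error term, which is finite.
    have := lintegral_energy_le_add (γ := γ) (f' := 0) (g' := derivWithin S (Icc 0 1))
      hΓ0 hΓ (M := M) (Filter.Eventually.of_forall fun u hu => by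
        rw [hdw ⟨by linarith [hu.1], by linarith [hu.2]⟩]; exact hM u hu) (fun u hu hn => by
        rw [hdw (Ioo_subset_Icc_self hu)]
        have hu0 := hu.1
        by_cases h : u < 1 / 4
        · exact hd0 (by rwa [abs_of_pos hu0])
        · exact hd1 (by rw [abs_of_pos hu0]; by_contra! h'; exact hn ⟨not_lt.1 h, h'⟩))
    refine ne_top_of_le_ne_top ?_ this
    simp [ENNReal.mul_eq_top]
  have hle := meanRate_mul_le_energyOne γ hS.contDiffOn
    (by rw [hdw (by simp)]; exact hd0 (by norm_num))
    (S.zero_of_le_dist (by simp [S]; norm_num))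
  intro htop
  rw [htop] at hle
  have hpos : ∫⁻ u in Ioo (0 : ℝ) 1, ENNReal.ofReal (S u ^ 2) ≠ 0 := by
    rw [← pos_iff_ne_zero]
    have hsub : Ioo (0 : ℝ) (1 / 4) ⊆ Ioo 0 1 := Ioo_subset_Ioo_right (by norm_num)
    refine lt_of_lt_of_le ?_ (lintegral_mono_set hsub)
    rw [setLIntegral_congr_fun (g := fun _ => 1) measurableSet_Ioo fun u hu => ?_]
    · simp
    · rw [S.one_of_mem_closedBall (by simp [S, abs_of_pos hu.1]; linarith [hu.2])]; simp
  rw [ENNReal.top_mul hpos] at hle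
  exact hE (top_le_iff.1 hle)

/-! ### Smoothing a corner -/

lemma exists_contDiff_cutoff : ∃ S : ℝ → ℝ, ∃ K : ℝ, ContDiff ℝ ∞ S ∧ (∀ x, |x| ≤ 1 → S x = 1) ∧
    (∀ x, 2 ≤ |x| → S x = 0) ∧ (∀ x, |S x| ≤ 1) ∧ ∀ x, |deriv S x| ≤ K := by
  let S : ContDiffBump (0 : ℝ) := ⟨1, 2, by norm_num, by norm_num⟩
  have hS : ContDiff ℝ ∞ S := S.contDiff
  obtain ⟨K, hK⟩ := (S.hasCompactSupport.deriv).exists_bound_of_continuous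
    (hS.continuous_deriv (by simp))
  exact ⟨S, K, hS, fun x hx => S.one_of_mem_closedBall (by simpa [S] using hx),
    fun x hx => S.zero_of_le_dist (by simpa [S] using hx),
    fun x => by rw [abs_of_nonneg S.nonneg]; exact S.le_one, hK⟩

/-- A function that is smooth on `[0,c]` and on `[c,1]` can be made smooth by flattening it near
`c`, without enlarging its derivative by more than a fixed factor. -/
lemma exists_smooth_modification {f : ℝ → ℝ} {c : ℝ} (hc : c ∈ Ioo (0 : ℝ) 1)
    (hf₁ : ContDiffOn ℝ ∞ f (Icc 0 c)) (hf₂ : ContDiffOn ℝ ∞ f (Icc c 1)) :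
    ∃ M, ∀ ε, 0 < ε → 2 * ε < c → 2 * ε < 1 - c → ∃ g : ℝ → ℝ, ContDiffOn ℝ ∞ g (Icc 0 1) ∧
      (∀ u, u ∉ Ioo (c - 2 * ε) (c + 2 * ε) → g u = f u) ∧
      ∀ u ∈ Ioo (0 : ℝ) 1, u ≠ c → |deriv g u| ≤ M := by
  obtain ⟨S, K, hS, hS1, hS0, hSle, hK⟩ := exists_contDiff_cutoff
  have hK0 : 0 ≤ K := (abs_nonneg _).trans (hK 0)
  have bound {a b : ℝ} (hab : a < b) (hf : ContDiffOn ℝ ∞ f (Icc a b)) :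
      ∃ L, ∀ u ∈ Icc a b, |derivWithin f (Icc a b) u| ≤ L :=
    isCompact_Icc.exists_bound_of_continuousOn
      (hf.continuousOn_derivWithin (uniqueDiffOn_Icc hab) (by simp))
  obtain ⟨L₁, hL₁⟩ := bound hc.1 hf₁
  obtain ⟨L₂, hL₂⟩ := bound hc.2 hf₂
  set L := max L₁ L₂
  have hL0 : 0 ≤ L := (abs_nonneg _).trans ((hL₁ c ⟨hc.1.le, le_rfl⟩).trans (le_max_left _ _))
  have hlip (u : ℝ) (hu : u ∈ Icc (0 : ℝ) 1) : |f c - f u| ≤ L * |c - u| := by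
    rcases le_total u c with h | h
    · exact (convex_Icc (0 : ℝ) c).norm_image_sub_le_of_norm_derivWithin_le
        (hf₁.differentiableOn (by simp)) (fun x hx => (hL₁ x hx).trans (le_max_left _ _))
        ⟨hu.1, h⟩ ⟨hc.1.le, le_rfl⟩
    · exact (convex_Icc c (1 : ℝ)).norm_image_sub_le_of_norm_derivWithin_le
        (hf₂.differentiableOn (by simp)) (fun x hx => (hL₂ x hx).trans (le_max_right _ _))
        ⟨h, hu.2⟩ ⟨le_rfl, hc.2.le⟩
  have hder (u : ℝ) (hu : u ∈ Ioo (0 : ℝ) 1) (huc : u ≠ c) :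
      DifferentiableAt ℝ f u ∧ |deriv f u| ≤ L := by
    rcases huc.lt_or_gt with h | h
    · have hn : Icc 0 c ∈ nhds u := Icc_mem_nhds hu.1 h
      refine ⟨(hf₁.differentiableOn (by simp)).differentiableAt hn, ?_⟩
      rw [← derivWithin_of_mem_nhds hn]
      exact (hL₁ u ⟨hu.1.le, h.le⟩).trans (le_max_left _ _)
    · have hn : Icc c 1 ∈ nhds u := Icc_mem_nhds h hu.2
      refine ⟨(hf₂.differentiableOn (by simp)).differentiableAt hn, ?_⟩
      rw [← derivWithin_of_mem_nhds hn]
      exact (hL₂ u ⟨h.le, hu.2.le⟩).trans (le_max_right _ _)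
  -- The three terms bound `f'`, the differentiated cutoff and `S f'`. In the middle one the factor
  -- `1/ε` is absorbed by `|f c - f u| ≤ L * (2 * ε)` on the support of the cutoff, so the bound is
  -- uniform in `ε`.
  refine ⟨L + (2 * K * L + L), fun ε hε h1 h2 => ?_⟩
  have hχ : ContDiff ℝ ∞ fun u => S ((u - c) / ε) :=
    hS.comp ((contDiff_id.sub contDiff_const).div_const ε)
  have habs (u : ℝ) : |(u - c) / ε| = |u - c| / ε := by rw [abs_div, abs_of_pos hε]
  -- Interpolates between `f` far from `c` and the constant `f c` within `ε` of it; being constant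
  -- there, it is smooth across the corner.
  refine ⟨fun u => f u + S ((u - c) / ε) * (f c - f u), ?_, ?_, ?_⟩
  · intro x hx
    rcases lt_trichotomy x c with h | rfl | h
    · have hfx : ContDiffWithinAt ℝ ∞ f (Icc 0 1) x := (hf₁ x ⟨hx.1, h.le⟩).mono_of_mem_nhdsWithin
        (by filter_upwards [self_mem_nhdsWithin, mem_nhdsWithin_of_mem_nhds (Iio_mem_nhds h)]
              with y hy hy'
            exact ⟨hy.1, le_of_lt hy'⟩)
      exact hfx.add (hχ.contDiffWithinAt.mul (contDiffWithinAt_const.sub hfx))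
    · refine (contDiffWithinAt_const (c := f x)).congr_of_eventuallyEq_of_mem ?_ hx
      filter_upwards [mem_nhdsWithin_of_mem_nhds (Metric.ball_mem_nhds x hε)] with y hy
      rw [hS1 _ (by rw [habs, div_le_one hε]; exact (Metric.mem_ball.1 hy).le)]
      ring
    · have hfx : ContDiffWithinAt ℝ ∞ f (Icc 0 1) x := (hf₂ x ⟨h.le, hx.2⟩).mono_of_mem_nhdsWithin
        (by filter_upwards [self_mem_nhdsWithin, mem_nhdsWithin_of_mem_nhds (Ioi_mem_nhds h)]
              with y hy hy'
            exact ⟨le_of_lt hy', hy.2⟩)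
      exact hfx.add (hχ.contDiffWithinAt.mul (contDiffWithinAt_const.sub hfx))
  · intro u hu
    have : 2 ≤ |(u - c) / ε| := by
      rw [habs, le_div_iff₀ hε]
      by_contra! h
      exact hu ⟨by linarith [(abs_lt.1 h).1], by linarith [(abs_lt.1 h).2]⟩
    simp [hS0 _ this]
  · intro u hu huc
    obtain ⟨hdf, hfL⟩ := hder u hu huc
    have hSd : HasDerivAt (fun u => S ((u - c) / ε)) (deriv S ((u - c) / ε) * (1 / ε)) u :=
      (hS.differentiable (by simp)).differentiableAt.hasDerivAt.comp u
        (((hasDerivAt_id u).sub_const c).div_const ε)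
    have hg := hdf.hasDerivAt.add (hSd.mul (hdf.hasDerivAt.const_sub (f c)))
    have hg' : deriv (fun u => f u + S ((u - c) / ε) * (f c - f u)) u = _ := hg.deriv
    rw [hg']
    have hA : |deriv S ((u - c) / ε) * (1 / ε) * (f c - f u)| ≤ 2 * K * L := by
      by_cases hfar : 2 < |(u - c) / ε|
      · have : deriv S ((u - c) / ε) = 0 := by
          have he : S =ᶠ[nhds ((u - c) / ε)] fun _ => 0 := by
            filter_upwards [(isOpen_lt continuous_const continuous_abs).mem_nhds hfar] with x hx
            exact hS0 x (le_of_lt hx)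
          rw [he.deriv_eq, deriv_const]
        rw [this]
        simp only [zero_mul, abs_zero]
        positivity
      · rw [not_lt, habs, div_le_iff₀ hε] at hfar
        have hl := hlip u (Ioo_subset_Icc_self hu)
        rw [abs_sub_comm c u] at hl
        calc |deriv S ((u - c) / ε) * (1 / ε) * (f c - f u)|
            = |deriv S ((u - c) / ε)| * (1 / ε) * |f c - f u| := by
              rw [abs_mul, abs_mul, abs_of_pos (one_div_pos.2 hε)]
          _ ≤ K * (1 / ε) * (L * (2 * ε)) := by
              have := hK ((u - c) / ε)
              have := hl.trans (mul_le_mul_of_nonneg_left hfar hL0)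
              gcongr
          _ = 2 * K * L := by field_simp
    have hB : |S ((u - c) / ε) * -deriv f u| ≤ L := by
      rw [abs_mul, abs_neg]
      calc _ ≤ 1 * L := mul_le_mul (hSle _) hfL (abs_nonneg _) zero_le_one
        _ = L := one_mul L
    exact (abs_add_le _ _).trans (add_le_add hfL ((abs_add_le _ _).trans (add_le_add hA hB)))

/-- The Rayleigh quotient bound for functions that are smooth except for one break point. -/
lemma meanRate_mul_le_of_piecewise {γ f : ℝ → ℝ} {c : ℝ} (hγ : ContinuousOn γ (Ioo 0 1))
    (hc : c ∈ Ioo (0 : ℝ) 1) (hf₁ : ContDiffOn ℝ ∞ f (Icc 0 c)) (hf₂ : ContDiffOn ℝ ∞ f (Icc c 1))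
    (h0 : derivWithin f (Icc 0 c) 0 = 0) (h1 : f 1 = 0) :
    meanRate γ * ∫⁻ u in Ioo (0 : ℝ) 1, ENNReal.ofReal (f u ^ 2) ≤
      ∫⁻ u in Ioo (0 : ℝ) 1, ENNReal.ofReal (γ u * deriv f u ^ 2) := by
  obtain ⟨M, hM⟩ := exists_smooth_modification hc hf₁ hf₂
  obtain ⟨B₁, hB₁⟩ := isCompact_Icc.exists_bound_of_continuousOn hf₁.continuousOn
  obtain ⟨B₂, hB₂⟩ := isCompact_Icc.exists_bound_of_continuousOn hf₂.continuousOn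
  set B := max B₁ B₂
  have hB (u : ℝ) (hu : u ∈ Icc (0 : ℝ) 1) : |f u| ≤ B := by
    rcases le_total u c with h | h
    · exact (hB₁ u ⟨hu.1, h⟩).trans (le_max_left _ _)
    · exact (hB₂ u ⟨h, hu.2⟩).trans (le_max_right _ _)
  obtain ⟨Γ, hΓ0, hΓ⟩ := exists_forall_Icc_le hγ (a := c / 2) (b := (c + 1) / 2)
    (by linarith [hc.1]) (by linarith [hc.2])
  set E := ∫⁻ u in Ioo (0 : ℝ) 1, ENNReal.ofReal (γ u * deriv f u ^ 2)
  -- This range of `ε` keeps the window `[c - 2ε, c + 2ε]` inside `[c/2, (c+1)/2]`, where `Γ` bounds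
  -- `γ`.
  have key (ε : ℝ) (hε : ε ∈ Ioo 0 (min (c / 4) ((1 - c) / 4))) :
      meanRate γ * ∫⁻ u in Ioo (0 : ℝ) 1, ENNReal.ofReal (f u ^ 2) ≤
        E + ENNReal.ofReal (Γ * M ^ 2) * ENNReal.ofReal (4 * ε) +
          meanRate γ * (ENNReal.ofReal (1 * B ^ 2) * ENNReal.ofReal (4 * ε)) := by
    obtain ⟨hε0, hε⟩ := hε
    obtain ⟨hεc, hεc'⟩ := lt_min_iff.1 hε
    obtain ⟨g, hg, hgf, hgM⟩ := hM ε hε0 (by linarith) (by linarith)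
    have hw : c + 2 * ε - (c - 2 * ε) = 4 * ε := by ring
    have hnot {u : ℝ} (hu : u ∉ Icc (c - 2 * ε) (c + 2 * ε)) : g =ᶠ[nhds u] f := by
      filter_upwards [isClosed_Icc.isOpen_compl.mem_nhds hu] with x hx
      exact hgf x fun h => hx (Ioo_subset_Icc_self h)
    have hdg {u : ℝ} (hu : u ∈ Ioo (0 : ℝ) 1) : derivWithin g (Icc 0 1) u = deriv g u :=
      derivWithin_of_mem_nhds (Icc_mem_nhds hu.1 hu.2)
    have hE : energyOne γ g ≤ E + ENNReal.ofReal (Γ * M ^ 2) * ENNReal.ofReal (4 * ε) := by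
      rw [← hw]
      refine lintegral_energy_le_add hΓ0 (fun u hu => hΓ u ⟨by linarith [hu.1], by linarith [hu.2]⟩)
        ?_ fun u hu hn => by rw [hdg hu, (hnot hn).deriv_eq]
      filter_upwards [Measure.ae_ne volume c] with u huc hu
      have hu' : u ∈ Ioo (0 : ℝ) 1 := ⟨by linarith [hu.1], by linarith [hu.2]⟩
      rw [hdg hu']
      exact hgM u hu' huc
    have hg0 : derivWithin g (Icc 0 1) 0 = 0 := by
      have h0n : (0 : ℝ) ∉ Icc (c - 2 * ε) (c + 2 * ε) := fun h => by linarith [h.1]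
      rw [((hnot h0n).filter_mono nhdsWithin_le_nhds).derivWithin_eq_of_mem (by simp)]
      have hset : Icc (0 : ℝ) 1 =ᶠ[nhds 0] Icc 0 c := by
        filter_upwards [Iio_mem_nhds hc.1] with x hx
        exact propext ⟨fun h => ⟨h.1, le_of_lt hx⟩, fun h => ⟨h.1, h.2.trans hc.2.le⟩⟩
      exact (derivWithin_congr_set hset).trans h0
    have hle := meanRate_mul_le_energyOne γ hg hg0
      ((hgf 1 fun h => by linarith [h.2]).trans h1)
    have hf2 : ∫⁻ u in Ioo (0 : ℝ) 1, ENNReal.ofReal (f u ^ 2) ≤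
        (∫⁻ u in Ioo (0 : ℝ) 1, ENNReal.ofReal (g u ^ 2)) +
          ENNReal.ofReal (1 * B ^ 2) * ENNReal.ofReal (4 * ε) := by
      -- The energy comparison with weight 1, applied to the functions themselves in place of
      -- derivatives, compares the masses.
      have := lintegral_energy_le_add (γ := fun _ => 1) (f' := g) (g' := f) (Γ := 1) (M := B)
        (a := c - 2 * ε) (b := c + 2 * ε) zero_le_one (fun _ _ => le_rfl)
        (Filter.Eventually.of_forall fun u hu => hB u ⟨by linarith [hu.1], by linarith [hu.2]⟩)
        (fun u _ hn => (hnot hn).self_of_nhds.symm)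
      simpa only [one_mul, hw] using this
    calc _ ≤ meanRate γ * ((∫⁻ u in Ioo (0 : ℝ) 1, ENNReal.ofReal (g u ^ 2)) +
          ENNReal.ofReal (1 * B ^ 2) * ENNReal.ofReal (4 * ε)) := by gcongr
      _ ≤ _ := by
        rw [mul_add]
        gcongr
        exact hle.trans hE
  -- The mass error is multiplied by `meanRate γ`, so its vanishing in the limit relies on
  -- `meanRate_ne_top`.
  have hlim : Filter.Tendsto (fun ε : ℝ => E + ENNReal.ofReal (Γ * M ^ 2) * ENNReal.ofReal (4 * ε) +
      meanRate γ * (ENNReal.ofReal (1 * B ^ 2) * ENNReal.ofReal (4 * ε)))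
      (nhdsWithin 0 (Ioi 0)) (nhds (E + ENNReal.ofReal (Γ * M ^ 2) * 0 +
        meanRate γ * (ENNReal.ofReal (1 * B ^ 2) * 0))) := by
    have h4 : Filter.Tendsto (fun ε : ℝ => ENNReal.ofReal (4 * ε)) (nhdsWithin 0 (Ioi 0))
        (nhds 0) := by
      have : Continuous fun ε : ℝ => ENNReal.ofReal (4 * ε) :=
        ENNReal.continuous_ofReal.comp (continuous_const_mul 4)
      simpa using (this.tendsto 0).mono_left nhdsWithin_le_nhds
    refine (tendsto_const_nhds.add (ENNReal.Tendsto.const_mul h4 (Or.inr ENNReal.ofReal_ne_top))).add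
      (ENNReal.Tendsto.const_mul (ENNReal.Tendsto.const_mul h4 (Or.inr ENNReal.ofReal_ne_top))
        (Or.inr (meanRate_ne_top hγ)))
  simp only [mul_zero, add_zero] at hlim
  refine ge_of_tendsto hlim ?_
  filter_upwards [Ioo_mem_nhdsGT (lt_min (by linarith [hc.1] : 0 < c / 4)
    (by linarith [hc.2] : 0 < (1 - c) / 4))] with ε hε
  exact key ε hε

/-! ### Geometry of the triangle and Tonelli's theorem -/

lemma isOpen_triangle : IsOpen triangle := by
  refine (isOpen_lt continuous_const continuous_fst).inter
    ((isOpen_lt continuous_fst continuous_snd).inter (isOpen_lt continuous_snd continuous_const))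

lemma triangle_subset_closedTriangle : triangle ⊆ closedTriangle :=
  fun _ hp => ⟨hp.1.le, hp.2.1.le, hp.2.2.le⟩

lemma closedTriangle_mem_nhds {p : ℝ × ℝ} (hp : p ∈ triangle) : closedTriangle ∈ nhds p :=
  Filter.mem_of_superset (isOpen_triangle.mem_nhds hp) triangle_subset_closedTriangle

/-- A convex set with nonempty interior has unique derivatives; this makes `partialU` and `partialV`
meaningful up to the boundary. -/
lemma uniqueDiffOn_closedTriangle : UniqueDiffOn ℝ closedTriangle := by
  refine uniqueDiffOn_convex ?_ ⟨(1 / 4, 1 / 2), mem_interior_iff_mem_nhds.2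
    (closedTriangle_mem_nhds ⟨by norm_num, by norm_num, by norm_num⟩)⟩
  rintro x ⟨hx0, hx, hx1⟩ y ⟨hy0, hy, hy1⟩ a b ha hb hab
  refine ⟨add_nonneg (mul_nonneg ha hx0) (mul_nonneg hb hy0),
    add_le_add (mul_le_mul_of_nonneg_left hx ha) (mul_le_mul_of_nonneg_left hy hb), ?_⟩
  calc a * x.2 + b * y.2 ≤ a * 1 + b * 1 :=
        add_le_add (mul_le_mul_of_nonneg_left hx1 ha) (mul_le_mul_of_nonneg_left hy1 hb)
    _ = 1 := by rw [mul_one, mul_one, hab]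

lemma indicator_triangle_eq_of_mem_Ioo (A : ℝ × ℝ → ℝ≥0∞) {v : ℝ} (hv : v ∈ Ioo (0 : ℝ) 1) :
    (fun u => triangle.indicator A (u, v)) = (Ioo 0 v).indicator fun u => A (u, v) := by
  ext u
  by_cases h : u ∈ Ioo 0 v
  · rw [indicator_of_mem h, indicator_of_mem (show (u, v) ∈ triangle from ⟨h.1, h.2, hv.2⟩)]
  · rw [indicator_of_notMem h, indicator_of_notMem fun h' => h ⟨h'.1, h'.2.1⟩]

lemma indicator_triangle_eq_of_mem_Ioo' (A : ℝ × ℝ → ℝ≥0∞) {u : ℝ} (hu : u ∈ Ioo (0 : ℝ) 1) :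
    (fun v => triangle.indicator A (u, v)) = (Ioo u 1).indicator fun v => A (u, v) := by
  ext v
  by_cases h : v ∈ Ioo u 1
  · rw [indicator_of_mem h, indicator_of_mem (show (u, v) ∈ triangle from ⟨hu.1, h.1, h.2⟩)]
  · rw [indicator_of_notMem h, indicator_of_notMem fun h' => h h'.2]

/-- Tonelli's theorem on the triangle, sweeping the two summands along complementary segments. -/
lemma lintegral_triangle_add {A B : ℝ × ℝ → ℝ≥0∞} (hA : AEMeasurable A (volume.restrict triangle))
    (hB : AEMeasurable B (volume.restrict triangle)) :
    ∫⁻ p in triangle, (A p + B p) = ∫⁻ v in Ioo (0 : ℝ) 1,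
      ((∫⁻ u in Ioo 0 v, A (u, v)) + ∫⁻ u in Ioo v 1, B (v, u)) := by
  have hT := isOpen_triangle.measurableSet
  have hA' : AEMeasurable (triangle.indicator A) ((volume : Measure ℝ).prod volume) :=
    (aemeasurable_indicator_iff hT).2 hA
  have hB' : AEMeasurable (triangle.indicator B) ((volume : Measure ℝ).prod volume) :=
    (aemeasurable_indicator_iff hT).2 hB
  have e1 : ∫⁻ p in triangle, A p = ∫⁻ v in Ioo (0 : ℝ) 1, ∫⁻ u, triangle.indicator A (u, v) := by
    rw [← lintegral_indicator hT, Measure.volume_eq_prod, lintegral_prod_symm _ hA',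
      ← lintegral_indicator measurableSet_Ioo]
    refine lintegral_congr fun v => ?_
    by_cases hv : v ∈ Ioo (0 : ℝ) 1
    · rw [indicator_of_mem hv]
    · rw [indicator_of_notMem hv, ← lintegral_zero]
      exact lintegral_congr fun u =>
        indicator_of_notMem (fun h => hv ⟨h.1.trans h.2.1, h.2.2⟩) _
  have e2 : ∫⁻ p in triangle, B p = ∫⁻ v in Ioo (0 : ℝ) 1, ∫⁻ u, triangle.indicator B (v, u) := by
    rw [← lintegral_indicator hT, Measure.volume_eq_prod, lintegral_prod _ hB',
      ← lintegral_indicator measurableSet_Ioo]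
    refine lintegral_congr fun v => ?_
    by_cases hv : v ∈ Ioo (0 : ℝ) 1
    · rw [indicator_of_mem hv]
    · rw [indicator_of_notMem hv, ← lintegral_zero]
      exact lintegral_congr fun u =>
        indicator_of_notMem (fun h => hv ⟨h.1, h.2.1.trans h.2.2⟩) _
  rw [lintegral_add_left' hA, e1, e2,
    ← lintegral_add_right' _ (hB'.lintegral_prod_right').restrict]
  refine setLIntegral_congr_fun measurableSet_Ioo fun v hv => ?_
  rw [indicator_triangle_eq_of_mem_Ioo A hv, indicator_triangle_eq_of_mem_Ioo' B hv,
    lintegral_indicator measurableSet_Ioo, lintegral_indicator measurableSet_Ioo]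

lemma setLIntegral_Ioo_add {g : ℝ → ℝ≥0∞} {v : ℝ} (hv : v ∈ Ioo (0 : ℝ) 1) :
    (∫⁻ u in Ioo 0 v, g u) + ∫⁻ u in Ioo v 1, g u = ∫⁻ u in Ioo 0 1, g u := by
  rw [← Ioo_union_Ico_eq_Ioo hv.1 hv.2.le, lintegral_union measurableSet_Ico
    (disjoint_left.2 fun x hx hx' => not_lt.2 hx'.1 hx.2), setLIntegral_congr (Ioo_ae_eq_Ico (a := v))]

lemma aemeasurable_of_continuousOn_triangle {F : ℝ × ℝ → ℝ} (hF : ContinuousOn F triangle) :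
    AEMeasurable (fun p => ENNReal.ofReal (F p)) (volume.restrict triangle) :=
  (hF.aemeasurable isOpen_triangle.measurableSet).ennreal_ofReal

lemma continuousOn_fst_triangle {γ : ℝ → ℝ} (hγ : ContinuousOn γ (Ioo 0 1)) :
    ContinuousOn (fun p : ℝ × ℝ => γ p.1) triangle :=
  hγ.comp continuous_fst.continuousOn fun _ hp => ⟨hp.1, hp.2.1.trans hp.2.2⟩

lemma continuousOn_snd_triangle {γ : ℝ → ℝ} (hγ : ContinuousOn γ (Ioo 0 1)) :
    ContinuousOn (fun p : ℝ × ℝ => γ p.2) triangle :=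
  hγ.comp continuous_snd.continuousOn fun _ hp => ⟨hp.1.trans hp.2.1, hp.2.2⟩

/-! ### Lower bound by slicing the symmetric extension -/

section Slices

variable {ψ : ℝ × ℝ → ℝ}

lemma continuousOn_partialU (hψ : ContDiffOn ℝ ∞ ψ closedTriangle) :
    ContinuousOn (partialU ψ) closedTriangle :=
  (hψ.continuousOn_fderivWithin uniqueDiffOn_closedTriangle (by simp)).clm_apply continuousOn_const

lemma continuousOn_partialV (hψ : ContDiffOn ℝ ∞ ψ closedTriangle) :
    ContinuousOn (partialV ψ) closedTriangle :=
  (hψ.continuousOn_fderivWithin uniqueDiffOn_closedTriangle (by simp)).clm_apply continuousOn_const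

lemma hasDerivWithinAt_slice_fst (hψ : ContDiffOn ℝ ∞ ψ closedTriangle) {u v : ℝ} (hv : v ≤ 1)
    (hu : u ∈ Icc 0 v) :
    HasDerivWithinAt (fun x => ψ (x, v)) (partialU ψ (u, v)) (Icc 0 v) u :=
  HasFDerivWithinAt.comp_hasDerivWithinAt (f := fun x => (x, v)) (t := closedTriangle) u
    ((hψ.differentiableOn (by simp)) (u, v) ⟨hu.1, hu.2, hv⟩).hasFDerivWithinAt
    ((hasDerivWithinAt_id u _).prodMk (hasDerivWithinAt_const u _ v))
    (fun _ hx => ⟨hx.1, hx.2, hv⟩)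

lemma hasDerivWithinAt_slice_snd (hψ : ContDiffOn ℝ ∞ ψ closedTriangle) {u v : ℝ} (hv : 0 ≤ v)
    (hu : u ∈ Icc v 1) :
    HasDerivWithinAt (fun x => ψ (v, x)) (partialV ψ (v, u)) (Icc v 1) u :=
  HasFDerivWithinAt.comp_hasDerivWithinAt (f := fun x => (v, x)) (t := closedTriangle) u
    ((hψ.differentiableOn (by simp)) (v, u) ⟨hv, hu.1, hu.2⟩).hasFDerivWithinAt
    ((hasDerivWithinAt_const u _ v).prodMk (hasDerivWithinAt_id u _))
    (fun _ hx => ⟨hv, hx.1, hx.2⟩)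

/-- The one-dimensional bound along the slices of the symmetric extension of `ψ`. -/
lemma meanRate_mul_slice_le {γ : ℝ → ℝ} (hγ : ContinuousOn γ (Ioo 0 1))
    (hψ : ContDiffOn ℝ ∞ ψ closedTriangle) (h0 : ∀ v ∈ Icc (0 : ℝ) 1, partialU ψ (0, v) = 0)
    (h1 : ∀ u ∈ Icc (0 : ℝ) 1, ψ (u, 1) = 0) {v : ℝ} (hv : v ∈ Ioo (0 : ℝ) 1) :
    meanRate γ * ((∫⁻ u in Ioo 0 v, ENNReal.ofReal (ψ (u, v) ^ 2)) +
        ∫⁻ u in Ioo v 1, ENNReal.ofReal (ψ (v, u) ^ 2)) ≤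
      (∫⁻ u in Ioo 0 v, ENNReal.ofReal (γ u * partialU ψ (u, v) ^ 2)) +
        ∫⁻ u in Ioo v 1, ENNReal.ofReal (γ u * partialV ψ (v, u) ^ 2) := by
  set f : ℝ → ℝ := fun u => ψ (min u v, max u v) with hf
  have hfl {u : ℝ} (hu : u ≤ v) : f u = ψ (u, v) := by simp [hf, hu]
  have hfr {u : ℝ} (hu : v ≤ u) : f u = ψ (v, u) := by simp [hf, hu]
  have hf₁ : ContDiffOn ℝ ∞ f (Icc 0 v) :=
    (hψ.comp (contDiff_id.prodMk contDiff_const).contDiffOn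
      (fun x hx => ⟨hx.1, hx.2, hv.2.le⟩)).congr fun x hx => hfl hx.2
  have hf₂ : ContDiffOn ℝ ∞ f (Icc v 1) :=
    (hψ.comp (contDiff_const.prodMk contDiff_id).contDiffOn
      (fun x hx => ⟨hv.1.le, hx.1, hx.2⟩)).congr fun x hx => hfr hx.1
  have hd₁ {u : ℝ} (hu : u ∈ Icc 0 v) : HasDerivWithinAt f (partialU ψ (u, v)) (Icc 0 v) u :=
    (hasDerivWithinAt_slice_fst hψ hv.2.le hu).congr (fun x hx => hfl hx.2) (hfl hu.2)
  have hd₂ {u : ℝ} (hu : u ∈ Icc v 1) : HasDerivWithinAt f (partialV ψ (v, u)) (Icc v 1) u :=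
    (hasDerivWithinAt_slice_snd hψ hv.1.le hu).congr (fun x hx => hfr hx.1) (hfr hu.1)
  have hle := meanRate_mul_le_of_piecewise hγ hv hf₁ hf₂
    (by
      have hm : (0 : ℝ) ∈ Icc 0 v := ⟨le_rfl, hv.1.le⟩
      rw [(hd₁ hm).derivWithin (uniqueDiffOn_Icc hv.1 0 hm), h0 v ⟨hv.1.le, hv.2.le⟩])
    (by rw [hfr hv.2.le, h1 v ⟨hv.1.le, hv.2.le⟩])
  rw [← setLIntegral_Ioo_add hv, ← setLIntegral_Ioo_add hv] at hle
  convert hle using 2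
  · congr 1
    · exact setLIntegral_congr_fun measurableSet_Ioo fun u hu => by
        rw [hfl hu.2.le]
    · exact setLIntegral_congr_fun measurableSet_Ioo fun u hu => by
        rw [hfr hu.1.le]
  · exact setLIntegral_congr_fun measurableSet_Ioo fun u hu => by
      rw [((hd₁ (Ioo_subset_Icc_self hu)).hasDerivAt (Icc_mem_nhds hu.1 hu.2)).deriv]
  · exact setLIntegral_congr_fun measurableSet_Ioo fun u hu => by
      rw [((hd₂ (Ioo_subset_Icc_self hu)).hasDerivAt (Icc_mem_nhds hu.1 hu.2)).deriv]

end Slices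

/-- The two energy terms are swept in different directions, so that each is integrated along its
variable of differentiation. Together they form, for each `v`, the one-dimensional energy of the
full slice. Positivity of `γ` lets `ENNReal.ofReal` split over the sum. -/
lemma energyTwo_eq {γ : ℝ → ℝ} (hγ : ContinuousOn γ (Ioo 0 1)) (hpos : ∀ u ∈ Ioo (0 : ℝ) 1, 0 < γ u)
    {ψ : ℝ × ℝ → ℝ} (hψ : ContDiffOn ℝ ∞ ψ closedTriangle) :
    energyTwo γ ψ = ∫⁻ v in Ioo (0 : ℝ) 1,
      ((∫⁻ u in Ioo 0 v, ENNReal.ofReal (γ u * partialU ψ (u, v) ^ 2)) +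
        ∫⁻ u in Ioo v 1, ENNReal.ofReal (γ u * partialV ψ (v, u) ^ 2)) := by
  have hU := (continuousOn_partialU hψ).mono triangle_subset_closedTriangle
  have hV := (continuousOn_partialV hψ).mono triangle_subset_closedTriangle
  rw [← lintegral_triangle_add
    (A := fun p => ENNReal.ofReal (γ p.1 * partialU ψ p ^ 2))
    (B := fun p => ENNReal.ofReal (γ p.2 * partialV ψ p ^ 2))
    (aemeasurable_of_continuousOn_triangle ((continuousOn_fst_triangle hγ).mul (hU.pow 2)))
    (aemeasurable_of_continuousOn_triangle ((continuousOn_snd_triangle hγ).mul (hV.pow 2)))]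
  refine setLIntegral_congr_fun isOpen_triangle.measurableSet fun p hp => ?_
  exact ENNReal.ofReal_add
    (mul_nonneg (hpos _ ⟨hp.1, hp.2.1.trans hp.2.2⟩).le (sq_nonneg _))
    (mul_nonneg (hpos _ ⟨hp.1.trans hp.2.1, hp.2.2⟩).le (sq_nonneg _))

/-- The symmetric extension has twice the mass of `ψ`, as it covers the triangle and its reflection.
-/
lemma two_mul_lintegral_triangle_sq {ψ : ℝ × ℝ → ℝ} (hψ : ContinuousOn ψ triangle) :
    2 * ∫⁻ p in triangle, ENNReal.ofReal (ψ p ^ 2) = ∫⁻ v in Ioo (0 : ℝ) 1,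
      ((∫⁻ u in Ioo 0 v, ENNReal.ofReal (ψ (u, v) ^ 2)) +
        ∫⁻ u in Ioo v 1, ENNReal.ofReal (ψ (v, u) ^ 2)) := by
  have hm : AEMeasurable (fun p => ENNReal.ofReal (ψ p ^ 2)) (volume.restrict triangle) :=
    aemeasurable_of_continuousOn_triangle (hψ.pow 2)
  rw [← lintegral_triangle_add hm hm, lintegral_add_left' hm, two_mul]

lemma two_mul_meanRate_le_energyTwo {γ : ℝ → ℝ} (hγ : ContinuousOn γ (Ioo 0 1))
    (hpos : ∀ u ∈ Ioo (0 : ℝ) 1, 0 < γ u) {ψ : ℝ × ℝ → ℝ} (hψ : ψ ∈ testClassTwo) :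
    2 * meanRate γ ≤ energyTwo γ ψ := by
  obtain ⟨hs, hn, h0, h1, -⟩ := hψ
  have hc := hs.continuousOn.mono triangle_subset_closedTriangle
  have hn' := (lintegral_sq_eq_one_iff
    (hc.aestronglyMeasurable isOpen_triangle.measurableSet)).2 hn
  have h2 := two_mul_lintegral_triangle_sq hc
  rw [hn', mul_one] at h2
  rw [mul_comm, h2, energyTwo_eq hγ hpos hs, ← lintegral_const_mul' _ _ (meanRate_ne_top hγ)]
  exact setLIntegral_mono' measurableSet_Ioo fun v hv => meanRate_mul_slice_le hγ hs h0 h1 hv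

/-! ### Upper bound by product test functions -/

section Product

variable {φ : ℝ → ℝ}

lemma hasFDerivWithinAt_product (hφ : DifferentiableOn ℝ φ (Icc 0 1)) {p : ℝ × ℝ}
    (hp : p ∈ closedTriangle) :
    HasFDerivWithinAt (fun p : ℝ × ℝ => √2 * (φ p.1 * φ p.2))
      (√2 • (φ p.1 • derivWithin φ (Icc 0 1) p.2 • ContinuousLinearMap.snd ℝ ℝ ℝ +
        φ p.2 • derivWithin φ (Icc 0 1) p.1 • ContinuousLinearMap.fst ℝ ℝ ℝ)) closedTriangle p := by
  have hm1 : MapsTo Prod.fst closedTriangle (Icc (0 : ℝ) 1) := fun q hq =>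
    ⟨hq.1, hq.2.1.trans hq.2.2⟩
  have hm2 : MapsTo Prod.snd closedTriangle (Icc (0 : ℝ) 1) := fun q hq =>
    ⟨hq.1.trans hq.2.1, hq.2.2⟩
  exact (((hφ _ (hm1 hp)).hasDerivWithinAt.comp_hasFDerivWithinAt p hasFDerivWithinAt_fst hm1).mul
    ((hφ _ (hm2 hp)).hasDerivWithinAt.comp_hasFDerivWithinAt p hasFDerivWithinAt_snd hm2)).const_mul
    (√2)

lemma partialU_product (hφ : DifferentiableOn ℝ φ (Icc 0 1)) {p : ℝ × ℝ}
    (hp : p ∈ closedTriangle) : partialU (fun p : ℝ × ℝ => √2 * (φ p.1 * φ p.2)) p =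
      √2 * (φ p.2 * derivWithin φ (Icc 0 1) p.1) := by
  rw [partialU, (hasFDerivWithinAt_product hφ hp).fderivWithin (uniqueDiffOn_closedTriangle p hp)]
  simp

lemma partialV_product (hφ : DifferentiableOn ℝ φ (Icc 0 1)) {p : ℝ × ℝ}
    (hp : p ∈ closedTriangle) : partialV (fun p : ℝ × ℝ => √2 * (φ p.1 * φ p.2)) p =
      √2 * (φ p.1 * derivWithin φ (Icc 0 1) p.2) := by
  rw [partialV, (hasFDerivWithinAt_product hφ hp).fderivWithin (uniqueDiffOn_closedTriangle p hp)]
  simp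

lemma contDiffOn_product (hφ : ContDiffOn ℝ ∞ φ (Icc 0 1)) :
    ContDiffOn ℝ ∞ (fun p : ℝ × ℝ => √2 * (φ p.1 * φ p.2)) closedTriangle :=
  contDiffOn_const.mul
    ((hφ.comp contDiff_fst.contDiffOn fun _ hq => ⟨hq.1, hq.2.1.trans hq.2.2⟩).mul
      (hφ.comp contDiff_snd.contDiffOn fun _ hq => ⟨hq.1.trans hq.2.1, hq.2.2⟩))

lemma ofReal_mul_two_sq (g a b : ℝ) :
    ENNReal.ofReal (g * (√2 * (a * b)) ^ 2) =
      2 * ENNReal.ofReal (a ^ 2) * ENNReal.ofReal (g * b ^ 2) := by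
  rw [← ENNReal.ofReal_ofNat 2, ← ENNReal.ofReal_mul zero_le_two,
    ← ENNReal.ofReal_mul (by positivity), mul_pow, Real.sq_sqrt zero_le_two]
  ring_nf

/-- For a product, the two half-slices carry the same integrand and join into one integral over
`(0,1)`. It serves for the mass (`g = 1`, `h = φ`) and for the energy (`g = γ`, `h = φ'`). -/
lemma setLIntegral_product_add (g h : ℝ → ℝ) {v : ℝ} (hv : v ∈ Ioo (0 : ℝ) 1) :
    ((∫⁻ u in Ioo 0 v, ENNReal.ofReal (g u * (√2 * (φ v * h u)) ^ 2)) +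
      ∫⁻ u in Ioo v 1, ENNReal.ofReal (g u * (√2 * (φ v * h u)) ^ 2)) =
    2 * ENNReal.ofReal (φ v ^ 2) * ∫⁻ u in Ioo 0 1, ENNReal.ofReal (g u * h u ^ 2) := by
  rw [setLIntegral_Ioo_add hv, ← lintegral_const_mul' _ _ (by finiteness)]
  simp only [ofReal_mul_two_sq]

lemma lintegral_sq_of_mem_testClassOne (hφ : φ ∈ testClassOne) :
    ∫⁻ u in Ioo (0 : ℝ) 1, ENNReal.ofReal (φ u ^ 2) = 1 :=
  (lintegral_sq_eq_one_iff ((hφ.1.continuousOn.mono Ioo_subset_Icc_self).aestronglyMeasurable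
    measurableSet_Ioo)).2 hφ.2.1

lemma lintegral_two_mul_sq_mul (hφ : φ ∈ testClassOne) (c : ℝ≥0∞) :
    ∫⁻ v in Ioo (0 : ℝ) 1, 2 * ENNReal.ofReal (φ v ^ 2) * c = 2 * c := by
  have hm : AEMeasurable (fun v => 2 * ENNReal.ofReal (φ v ^ 2)) (volume.restrict (Ioo 0 1)) :=
    ((((hφ.1.continuousOn.mono Ioo_subset_Icc_self).pow 2).aemeasurable
      measurableSet_Ioo).ennreal_ofReal).const_mul 2
  rw [lintegral_mul_const'' c hm, lintegral_const_mul' _ _ (by finiteness),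
    lintegral_sq_of_mem_testClassOne hφ, mul_one]

lemma product_mem_testClassTwo (hφ : φ ∈ testClassOne) :
    (fun p : ℝ × ℝ => √2 * (φ p.1 * φ p.2)) ∈ testClassTwo := by
  obtain ⟨hs, -, h0, h1⟩ := id hφ
  have hd := hs.differentiableOn (by simp)
  have hc := (contDiffOn_product hs).continuousOn.mono triangle_subset_closedTriangle
  refine ⟨contDiffOn_product hs, ?_, fun v hv => ?_, fun u _ => by simp [h1], fun u hu => ?_⟩
  · rw [← lintegral_sq_eq_one_iff (hc.aestronglyMeasurable isOpen_triangle.measurableSet)]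
    have h2 := two_mul_lintegral_triangle_sq hc
    -- Each slice of the product has mass `2 φ(v)²`, so the doubled mass is 2 and the mass on the
    -- triangle is 1.
    rw [setLIntegral_congr_fun measurableSet_Ioo fun v hv =>
      show _ = 2 * ENNReal.ofReal (φ v ^ 2) * 1 from ?_, lintegral_two_mul_sq_mul hφ] at h2
    · exact (ENNReal.mul_right_inj two_ne_zero (by finiteness)).1 h2
    · have := setLIntegral_product_add (φ := φ) (fun _ => 1) φ hv
      simp only [one_mul, lintegral_sq_of_mem_testClassOne hφ] at this
      simpa only [mul_comm (φ _) (φ v)] using this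
  · rw [partialU_product hd ⟨le_rfl, hv.1, hv.2⟩]
    simp [h0]
  · rw [partialU_product hd ⟨hu.1, le_rfl, hu.2⟩, partialV_product hd ⟨hu.1, le_rfl, hu.2⟩, sub_self]

lemma energyTwo_product {γ : ℝ → ℝ} (hγ : ContinuousOn γ (Ioo 0 1))
    (hpos : ∀ u ∈ Ioo (0 : ℝ) 1, 0 < γ u) (hφ : φ ∈ testClassOne) :
    energyTwo γ (fun p : ℝ × ℝ => √2 * (φ p.1 * φ p.2)) = 2 * energyOne γ φ := by
  have hd := hφ.1.differentiableOn (by simp)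
  rw [energyTwo_eq hγ hpos (contDiffOn_product hφ.1), ← lintegral_two_mul_sq_mul hφ]
  refine setLIntegral_congr_fun measurableSet_Ioo fun v hv => ?_
  refine Eq.trans ?_ (setLIntegral_product_add γ (derivWithin φ (Icc 0 1)) hv)
  congr 1
  · exact setLIntegral_congr_fun measurableSet_Ioo fun u hu => by
      rw [partialU_product hd ⟨hu.1.le, hu.2.le, hv.2.le⟩]
  · exact setLIntegral_congr_fun measurableSet_Ioo fun u hu => by
      rw [partialV_product hd ⟨hv.1.le, hu.1.le, hu.2.le⟩]

end Product

lemma secondMomentRate_eq {γ : ℝ → ℝ} (hγ : ContinuousOn γ (Ioo 0 1))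
    (hpos : ∀ u ∈ Ioo (0 : ℝ) 1, 0 < γ u) : secondMomentRate γ = 2 * meanRate γ := by
  refine le_antisymm ?_ (le_iInf₂ fun ψ hψ => two_mul_meanRate_le_energyTwo hγ hpos hψ)
  rw [meanRate, ENNReal.mul_iInf_of_ne two_ne_zero (by finiteness)]
  refine le_iInf fun φ => ?_
  rw [ENNReal.mul_iInf_of_ne two_ne_zero (by finiteness)]
  refine le_iInf fun hφ => ?_
  rw [← energyTwo_product hγ hpos hφ]
  exact iInf₂_le _ (product_mem_testClassTwo hφ)

end RandomWaveguide

theorem mainTheorem1 (γ : ℝ → ℝ)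
    (hγ_smooth : ContDiffOn ℝ ∞ γ (Ioo 0 1))
    (hγ_pos : ∀ u ∈ Ioo (0 : ℝ) 1, 0 < γ u) :
    RandomWaveguide.meanRate γ ≠ ⊤ ∧
      RandomWaveguide.secondMomentRate γ ≠ ⊤ ∧
      RandomWaveguide.secondMomentRate γ = 2 * RandomWaveguide.meanRate γ := by
  have hγ := hγ_smooth.continuousOn
  have htop := RandomWaveguide.meanRate_ne_top hγ
  have heq := RandomWaveguide.secondMomentRate_eq hγ hγ_pos
  exact ⟨htop, by rw [heq]; exact ENNReal.mul_ne_top (by finiteness) htop, heq⟩
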